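/- Theorem 1 (a Gauss-Kuzmin theorem for $T_N$). Fix an integer $N \ge 1$, let $I=[0,1]$ with its Borel $\sigma$-algebra $\mathcal B_I$, and let $T_N : I \to I$ be given by $T_N(0)=0$ and $T_N(x) = \frac{N}{x} - \left\lfloor \frac{N}{x}\right\rfloor$ for $x \neq 0$. Write $T_N^n$ for the $n$-th iterate of $T_N$, and $\mu(T_N^n < x) := \mu(\{y \in I : T_N^n(y) < x\})$. (i) Let $\mu$ be a probability measure on $(I,\mathcal B_I)$ which is non-atomic and has a Riemann-integrable density with respect to Lebesgue measure. Then $$\lim_{n\to\infty} \mu(T_N^n < x) = \frac{1}{\log\frac{N+1}{N}} \log\frac{x+N}{N} \qquad \text{for every } x \in I.$$ (ii) If, in addition to the assumptions on $\mu$ in (i), the density of $\mu$ (that is, of the distribution function $x \mapsto \mu([0,x])$) is Lipschitz continuous on $I$, then there exist positive constants $q<1$ and $\ell$ such that for every $x \in I$ and $n \ge 1$ there exists a real number $\theta=\theta(N,\mu,n,x)$ with $|\theta| \le \ell$ and $$\mu(T_N^n < x) = \frac{1+\theta q^n}{\log\frac{N+1}{N}} \log\frac{x+N}{N}.$$ Consequently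 the $n$-th error term $e_n(N,\mu;x) := \mu(T_N^n < x) - \frac{1}{\log\frac{N+1}{N}} \log\frac{x+N}{N}$ is given, with the same $\theta$, by $$e_n(N,\mu;x) = \frac{\theta q^n}{\log\frac{N+1}{N}} \log\frac{x+N}{N}.$$ -/

import Mathlib

open MeasureTheory Filter Topology

noncomputable section

namespace NCF

/-- The `N`-continued fraction map on `[0, 1]`:
`T_N x = N / x - ⌊N / x⌋` for `x ≠ 0`, and `T_N 0 = 0`. -/
def T (N : ℕ) (x : unitInterval) : unitInterval :=
  if (x : ℝ) = 0 then 0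
  else ⟨(N : ℝ) / x - ⌊(N : ℝ) / x⌋,
    Int.fract_nonneg _, (Int.fract_lt_one _).le⟩

/-- The box in `ℝ¹` whose closure is `[0, 1]`. -/
def unitBox : BoxIntegral.Box (Fin 1) where
  lower := fun _ => 0
  upper := fun _ => 1
  lower_lt_upper := fun _ => zero_lt_one

/-- Riemann integrability on `[0, 1]` of a real function: Riemann sums over tagged partitions of
`[0, 1]`, with each tag in its own closed subinterval, converge as the mesh tends to `0`.
The function is extended to `ℝ` only to be fed to Mathlib's integral; values of the extension
outside `[0, 1]` are never used, because all tags lie in `[0, 1]`. -/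
def RiemannIntegrable (h : unitInterval → ℝ) : Prop :=
  BoxIntegral.Integrable unitBox BoxIntegral.IntegrationParams.Riemann
    (fun t : Fin 1 → ℝ => Set.IccExtend (zero_le_one' ℝ) h (t 0))
    BoxIntegral.BoxAdditiveMap.volume

/-- `h ≥ 0` is a density of `μ` with respect to Lebesgue measure on `[0, 1]`. -/
def HasDensity (μ : Measure unitInterval) (h : unitInterval → ℝ) : Prop :=
  (∀ x, 0 ≤ h x) ∧ μ = (volume : Measure unitInterval).withDensity fun x => ENNReal.ofReal (h x)

/-- `μ` is non-atomic and has a Riemann-integrable density. -/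
def AssumptionA (μ : Measure unitInterval) : Prop :=
  NullSingletonClass μ ∧ ∃ h : unitInterval → ℝ, HasDensity μ h ∧ RiemannIntegrable h

/-- `μ` has a Lipschitz continuous density. -/
def HasLipschitzDensity (μ : Measure unitInterval) : Prop :=
  ∃ h : unitInterval → ℝ, HasDensity μ h ∧ ∃ K : NNReal, LipschitzWith K h

/-- `μ (T_N ^ n < x)`. -/
def distrib (N : ℕ) (μ : Measure unitInterval) (n : ℕ) (x : unitInterval) : ℝ :=
  μ.real {y | (T N)^[n] y < x}

/-- The limit distribution `log ((x + N) / N) / log ((N + 1) / N)`. -/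
def limitDistrib (N : ℕ) (x : unitInterval) : ℝ :=
  1 / Real.log (((N : ℝ) + 1) / N) * Real.log (((x : ℝ) + N) / N)

/-- The `n`-th error term of the Gauss-Kuzmin problem: the difference between `μ (T_N ^ n < x)`
and its limit. -/
def errorTerm (N : ℕ) (μ : Measure unitInterval) (n : ℕ) (x : unitInterval) : ℝ :=
  distrib N μ n x - limitDistrib N x

end NCF

end

namespace NCF

/-! Write a density as `f x / (x + N)`, that is, relative to the measure `dx / (x + N)`. Changing
variables on each inverse branch shows that applying the map once replaces `f` by `transfer N f`, an
average of `f` over the branch points with weights `digitProb N k t` of total mass 1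
(`integral_comp_realMap`). Constants are fixed, so `dx / (x + N)` is invariant, and its distribution
function is the logarithm in the limit.

Convergence comes from `LipUnit.transfer`: one step multiplies a Lipschitz constant on `[0, 1]` by
`7 / 8`. After `n` steps the function oscillates by at most `L * (7 / 8) ^ n`, while its integral
against `dx / (x + N)` is unchanged, so it is that close to its mean. Integrating over `(0, x]`
keeps the factor `log ((x + N) / N)` in the error, as the relative form of (ii) requires.

For (i) the density is approximated in `L¹` by a polynomial, which is Lipschitz; the error made on
any event is at most the `L¹` distance, uniformly in `n`. -/

/-! ### The transfer operator and Lipschitz functions on `[0, 1]`. -/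

/-- The transition probabilities `P_k(t)` of the `N`-continued fraction chain; the digit is `N + k`. -/
noncomputable def digitProb (N k : ℕ) (t : ℝ) : ℝ := (t + N) / ((t + N + k) * (t + N + k + 1))

/-- The tails `∑_{j ≥ k} P_j(t)`. -/
noncomputable def digitTail (N k : ℕ) (t : ℝ) : ℝ := (t + N) / (t + N + k)

/-- The inverse branch of the map for the digit `N + k`. -/
noncomputable def branch (N k : ℕ) (t : ℝ) : ℝ := N / (t + N + k)

/-- The transfer operator of the map with respect to its invariant measure. -/
noncomputable def transfer (N : ℕ) (f : ℝ → ℝ) (t : ℝ) : ℝ :=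
  ∑' k, digitProb N k t * f (branch N k t)

/-- `f` is Lipschitz on `[0, 1]` with constant `L`. -/
def LipUnit (L : ℝ) (f : ℝ → ℝ) : Prop :=
  ∀ x ∈ Set.Icc (0 : ℝ) 1, ∀ y ∈ Set.Icc (0 : ℝ) 1, |f x - f y| ≤ L * |x - y|

theorem LipUnit.nonneg {L : ℝ} {f : ℝ → ℝ} (hf : LipUnit L f) : 0 ≤ L := by
  have h := hf 1 (by simp) 0 (by simp)
  simp only [sub_zero, abs_one, mul_one] at h
  exact (abs_nonneg _).trans h

theorem LipUnit.abs_le {L : ℝ} {f : ℝ → ℝ} (hf : LipUnit L f) {x : ℝ}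
    (hx : x ∈ Set.Icc (0 : ℝ) 1) : |f x| ≤ |f 0| + L := by
  have h := hf x hx 0 (by simp)
  have h1 : |x - 0| ≤ 1 := by rw [sub_zero, abs_of_nonneg hx.1]; exact hx.2
  have h2 : |f x| ≤ |f x - f 0| + |f 0| := by simpa using abs_add_le (f x - f 0) (f 0)
  nlinarith [hf.nonneg]

theorem LipUnit.continuousOn {L : ℝ} {f : ℝ → ℝ} (hf : LipUnit L f) :
    ContinuousOn f (Set.Icc 0 1) := by
  have : LipschitzOnWith (Real.toNNReal L) f (Set.Icc 0 1) := by
    refine LipschitzOnWith.of_dist_le_mul fun x hx y hy => ?_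
    rw [Real.coe_toNNReal _ hf.nonneg]
    exact hf x hx y hy
  exact this.continuousOn

/-- Telescoping series. -/
theorem hasSum_telescope {u : ℕ → ℝ} {l : ℝ} (hs : Summable fun k => u k - u (k + 1))
    (hu : Tendsto u atTop (𝓝 l)) : HasSum (fun k => u k - u (k + 1)) (u 0 - l) := by
  have h1 := hs.hasSum.tendsto_sum_nat
  simp only [Finset.sum_range_sub'] at h1
  have h2 := tendsto_nhds_unique h1 (tendsto_const_nhds.sub hu)
  exact h2 ▸ hs.hasSum

theorem hasSum_telescope_of_antitone {u : ℕ → ℝ} {l : ℝ} (ha : ∀ k, u (k + 1) ≤ u k)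
    (hu : Tendsto u atTop (𝓝 l)) : HasSum (fun k => u k - u (k + 1)) (u 0 - l) := by
  rw [hasSum_iff_tendsto_nat_of_nonneg (fun k => sub_nonneg.2 (ha k))]
  simp only [Finset.sum_range_sub']
  exact tendsto_const_nhds.sub hu

/-! ### Digit probabilities, their tails, and inverse branches. -/

section

variable {N : ℕ} {t : ℝ}

theorem digitProb_nonneg (ht : 0 ≤ t) (k : ℕ) : 0 ≤ digitProb N k t := by
  unfold digitProb; positivity

theorem digitProb_eq_tail_sub (hN : 1 ≤ N) (ht : 0 ≤ t) (k : ℕ) :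
    digitProb N k t = digitTail N k t - digitTail N (k + 1) t := by
  have : (1 : ℝ) ≤ N := by exact_mod_cast hN
  unfold digitProb digitTail
  have h1 : t + N + k ≠ 0 := by positivity
  have h2 : t + N + k + 1 ≠ 0 := by positivity
  push_cast
  rw [← add_assoc]
  field_simp
  ring

theorem digitTail_zero (hN : 1 ≤ N) (ht : 0 ≤ t) : digitTail N 0 t = 1 := by
  have : (1 : ℝ) ≤ N := by exact_mod_cast hN
  unfold digitTail
  have h1 : t + N ≠ 0 := by positivity
  simp [h1]

theorem tendsto_add_natCast (a : ℝ) : Tendsto (fun k : ℕ => a + k) atTop atTop :=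
  tendsto_atTop_add_const_left _ _ tendsto_natCast_atTop_atTop

theorem tendsto_digitTail : Tendsto (fun k => digitTail N k t) atTop (𝓝 0) :=
  (tendsto_add_natCast _).const_div_atTop _

theorem hasSum_digitProb (hN : 1 ≤ N) (ht : 0 ≤ t) : HasSum (fun k => digitProb N k t) 1 := by
  have h := hasSum_telescope_of_antitone (u := fun k => digitTail N k t)
    (fun k => sub_nonneg.1 (digitProb_eq_tail_sub hN ht k ▸ digitProb_nonneg ht k))
    tendsto_digitTail
  rw [digitTail_zero hN ht, sub_zero] at h
  simpa only [digitProb_eq_tail_sub hN ht] using h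

theorem branch_mem (hN : 1 ≤ N) (ht : 0 ≤ t) (k : ℕ) : branch N k t ∈ Set.Icc (0 : ℝ) 1 := by
  have : (1 : ℝ) ≤ N := by exact_mod_cast hN
  unfold branch
  refine ⟨by positivity, ?_⟩
  rw [div_le_one (by positivity)]
  have : (0 : ℝ) ≤ k := by positivity
  linarith

theorem branch_sub_branch (hN : 1 ≤ N) {x y : ℝ} (hx : 0 ≤ x) (hy : 0 ≤ y) (k : ℕ) :
    |branch N k x - branch N k y| = N / ((x + N + k) * (y + N + k)) * |x - y| := by
  have : (1 : ℝ) ≤ N := by exact_mod_cast hN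
  have h1 : x + N + k ≠ 0 := by positivity
  have h2 : y + N + k ≠ 0 := by positivity
  have : branch N k x - branch N k y = N / ((x + N + k) * (y + N + k)) * -(x - y) := by
    unfold branch
    field_simp
    ring
  rw [this, abs_mul, abs_neg, abs_of_nonneg (by positivity)]

theorem branch_succ_sub_branch (hN : 1 ≤ N) (ht : 0 ≤ t) (k : ℕ) :
    |branch N (k + 1) t - branch N k t| = N / ((t + N + k) * (t + N + k + 1)) := by
  have : (1 : ℝ) ≤ N := by exact_mod_cast hN
  have h1 : t + N + k ≠ 0 := by positivity
  have h2 : t + N + k + 1 ≠ 0 := by positivity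
  have : branch N (k + 1) t - branch N k t = -(N / ((t + N + k) * (t + N + k + 1))) := by
    unfold branch
    push_cast
    rw [← add_assoc]
    field_simp
    ring
  rw [this, abs_neg, abs_of_nonneg (by positivity)]

theorem digitTail_sub_digitTail (hN : 1 ≤ N) {x y : ℝ} (hx : 0 ≤ x) (hy : 0 ≤ y) (k : ℕ) :
    |digitTail N k x - digitTail N k y| = k / ((x + N + k) * (y + N + k)) * |x - y| := by
  have : (1 : ℝ) ≤ N := by exact_mod_cast hN
  have h1 : x + N + k ≠ 0 := by positivity
  have h2 : y + N + k ≠ 0 := by positivity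
  have : digitTail N k x - digitTail N k y = k / ((x + N + k) * (y + N + k)) * (x - y) := by
    unfold digitTail
    field_simp
    ring
  rw [this, abs_mul, abs_of_nonneg (a := (k : ℝ) / _) (by positivity)]

theorem summable_transfer (hN : 1 ≤ N) {L : ℝ} {f : ℝ → ℝ} (hf : LipUnit L f) (ht : 0 ≤ t) :
    Summable fun k => digitProb N k t * f (branch N k t) := by
  refine Summable.of_norm_bounded ((hasSum_digitProb hN ht).summable.mul_right (|f 0| + L))
    fun k => ?_
  rw [norm_mul, Real.norm_of_nonneg (digitProb_nonneg ht k)]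
  exact mul_le_mul_of_nonneg_left (hf.abs_le (branch_mem hN ht k)) (digitProb_nonneg ht k)

/-! ### Contraction of Lipschitz constants. -/

/-- Telescopes through `N / (2 (N + k) (N + k + 1))`. The series majorizes the change of weights
between two points, after summation by parts. -/
theorem hasSum_inv_three (hN : 1 ≤ N) :
    HasSum (fun k : ℕ => (N : ℝ) / ((N + k) * (N + k + 1) * (N + k + 2)))
      (1 / (2 * ((N : ℝ) + 1))) := by
  have h0 : (1 : ℝ) ≤ N := by exact_mod_cast hN
  have key : ∀ k : ℕ, (N : ℝ) / ((N + k) * (N + k + 1) * (N + k + 2)) =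
      (N : ℝ) / (2 * ((N + k) * (N + k + 1))) -
        (N : ℝ) / (2 * ((N + (k + 1 : ℕ)) * (N + (k + 1 : ℕ) + 1))) := by
    intro k
    have h1 : (N : ℝ) + k ≠ 0 := by positivity
    have h2 : (N : ℝ) + k + 1 ≠ 0 := by positivity
    have h3 : (N : ℝ) + k + 2 ≠ 0 := by positivity
    have h4 : (N : ℝ) + (k + 1 : ℕ) = N + k + 1 := by push_cast; ring
    have h5 : (N : ℝ) + k + 1 + 1 = N + k + 2 := by ring
    rw [h4, h5]
    field_simp
    ring
  have ht : Tendsto (fun k : ℕ => (N : ℝ) / (2 * ((N + k) * (N + k + 1)))) atTop (𝓝 0) := by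
    refine Tendsto.const_div_atTop ?_ _
    refine Tendsto.const_mul_atTop two_pos ?_
    exact (tendsto_add_natCast _).atTop_mul_atTop₀
      (tendsto_atTop_add_const_right _ _ (tendsto_add_natCast _))
  have h := hasSum_telescope_of_antitone (fun k => sub_nonneg.1 (key k ▸ by positivity)) ht
  simp only [← key] at h
  convert h using 1
  have h1 : (N : ℝ) ≠ 0 := by positivity
  simp
  field_simp

/-- Bound for the mean displacement between two points under the same digits. -/
theorem hasSum_digitProb_weight (hN : 1 ≤ N) (ht : 0 ≤ t) :
    HasSum (fun k => digitProb N k t * ((N : ℝ) / (N + 1) ^ 2) +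
      if k = 0 then digitProb N 0 t * (1 / (N : ℝ) - N / (N + 1) ^ 2) else 0)
      (1 * ((N : ℝ) / (N + 1) ^ 2) + digitProb N 0 t * (1 / (N : ℝ) - N / (N + 1) ^ 2)) :=
  ((hasSum_digitProb hN ht).mul_right _).add (hasSum_ite_eq 0 _)

/-- The branch `k = 0` contracts only by `1 / N`, which is no gain for `N = 1`; every other branch
contracts at least by `N / (N + 1) ^ 2`. Separating `k = 0` lets its small probability compensate.
-/
theorem digitProb_mul_le_weight (hN : 1 ≤ N) {x y : ℝ} (hx : 0 ≤ x) (hy : 0 ≤ y) (k : ℕ) :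
    digitProb N k y * (N / ((x + N + k) * (y + N + k))) ≤
      digitProb N k y * ((N : ℝ) / (N + 1) ^ 2) +
      if k = 0 then digitProb N 0 y * (1 / (N : ℝ) - N / (N + 1) ^ 2) else 0 := by
  have h0 : (1 : ℝ) ≤ N := by exact_mod_cast hN
  rcases k with _ | k
  · simp only [if_true, ← mul_add]
    refine mul_le_mul_of_nonneg_left ?_ (digitProb_nonneg hy 0)
    have : (N : ℝ) / (N * N) = 1 / N := by field_simp
    rw [add_sub_cancel, ← this]
    simp only [CharP.cast_eq_zero, add_zero]
    gcongr <;> linarith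
  · simp only [Nat.succ_ne_zero, if_false, add_zero]
    refine mul_le_mul_of_nonneg_left ?_ (digitProb_nonneg hy _)
    have hk : (0 : ℝ) ≤ k := by positivity
    rw [sq]
    push_cast
    gcongr <;> linarith

/-- The value `7 / 8` is attained at `N = 1`, `t = 0`, where the terms are `1/4 + 1/4 + 3/8`. -/
theorem contraction_constant (hN : 1 ≤ N) (ht : 0 ≤ t) :
    1 / (2 * ((N : ℝ) + 1)) +
      (1 * ((N : ℝ) / (N + 1) ^ 2) + digitProb N 0 t * (1 / (N : ℝ) - N / (N + 1) ^ 2)) ≤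
      7 / 8 := by
  have h0 : (1 : ℝ) ≤ N := by exact_mod_cast hN
  have h1 : digitProb N 0 t ≤ 1 / ((N : ℝ) + 1) := by
    unfold digitProb
    have : t + (N : ℝ) ≠ 0 := by positivity
    simp only [CharP.cast_eq_zero, add_zero]
    rw [div_mul_cancel_left₀ this, ← one_div]
    gcongr
    linarith
  have h2 : 0 ≤ 1 / (N : ℝ) - N / (N + 1) ^ 2 := by
    rw [sub_nonneg, div_le_div_iff₀ (by positivity) (by positivity)]
    nlinarith
  have h3 := mul_le_mul_of_nonneg_right h1 h2
  refine (add_le_add_right (add_le_add_right h3 _) _).trans ?_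
  rcases hN.eq_or_lt with rfl | h
  · norm_num
  have h4 : (2 : ℝ) ≤ N := by exact_mod_cast h
  rw [← sub_nonneg]
  have : (7 / 8 : ℝ) - (1 / (2 * ((N : ℝ) + 1)) + (1 * ((N : ℝ) / (N + 1) ^ 2) +
      1 / ((N : ℝ) + 1) * (1 / (N : ℝ) - N / (N + 1) ^ 2))) =
      (7 * N * (N + 1) ^ 3 - 4 * N * (N + 1) ^ 2 - 8 * N ^ 2 * (N + 1) - 8 * (N + 1) ^ 2 + 8 * N ^ 2) / (8 * N * (N + 1) ^ 3) := by
    field_simp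
    ring
  rw [this]
  refine div_nonneg ?_ (by positivity)
  -- In powers of `s = N - 2` the numerator has only nonnegative coefficients.
  obtain ⟨s, hs⟩ : ∃ s : ℝ, (N : ℝ) = s + 2 := ⟨N - 2, by ring⟩
  have : 0 ≤ s := by linarith
  rw [hs]
  ring_nf
  positivity

end

/-- The transfer operator contracts Lipschitz constants. -/
theorem LipUnit.transfer {N : ℕ} (hN : 1 ≤ N) {L : ℝ} {f : ℝ → ℝ} (hf : LipUnit L f) :
    LipUnit (L * (7 / 8)) (transfer N f) := by
  have h0 : (1 : ℝ) ≤ N := by exact_mod_cast hN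
  have hL := hf.nonneg
  rintro x ⟨hx, -⟩ y ⟨hy, -⟩
  set D : ℕ → ℝ := fun k => digitTail N k x - digitTail N k y with hD
  set F : ℕ → ℝ := fun k => f (branch N k x) with hF
  set B : ℝ := 1 * ((N : ℝ) / (N + 1) ^ 2) +
    digitProb N 0 y * (1 / (N : ℝ) - N / (N + 1) ^ 2) with hB
  have hG1 := (hasSum_inv_three hN).mul_left (L * |x - y|)
  have hG2 := (hasSum_digitProb_weight hN hy).mul_left (L * |x - y|)
  have b1 : ∀ k, ‖D (k + 1) * (F (k + 1) - F k)‖ ≤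
      L * |x - y| * ((N : ℝ) / ((N + k) * (N + k + 1) * (N + k + 2))) := by
    intro k
    have e1 := hf _ (branch_mem hN hx (k + 1)) _ (branch_mem hN hx k)
    rw [branch_succ_sub_branch hN hx] at e1
    rw [norm_mul, Real.norm_eq_abs, Real.norm_eq_abs, hD, digitTail_sub_digitTail hN hx hy]
    have hk : (0 : ℝ) ≤ k := by positivity
    calc _ ≤ ((k + 1 : ℕ) : ℝ) / ((x + N + (k + 1 : ℕ)) * (y + N + (k + 1 : ℕ))) * |x - y| *
          (L * (N / ((x + N + k) * (x + N + k + 1)))) := by gcongr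
      _ ≤ ((k + 1 : ℕ) : ℝ) / ((0 + N + (k + 1 : ℕ)) * (0 + N + (k + 1 : ℕ))) * |x - y| *
          (L * (N / ((0 + N + k) * (0 + N + k + 1)))) := by gcongr
      _ = L * |x - y| * (N / ((N + k) * (N + k + 1)) *
            ((k + 1) / ((N + k + 1) * (N + k + 1)))) := by
          push_cast; ring
      -- With `a = N + k + 1` and `N ≥ 1`, this is `(k + 1) (a + 1) ≤ (a - 1) (a + 1) ≤ a ^ 2`.
      _ ≤ L * |x - y| * (N / ((N + k) * (N + k + 1)) * (1 / (N + k + 2))) := by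
          gcongr _ * (_ * ?_)
          rw [div_le_div_iff₀ (by positivity) (by positivity)]
          nlinarith
      _ = _ := by
          congr 1
          field_simp
  have b2 : ∀ k, ‖digitProb N k y * (F k - f (branch N k y))‖ ≤
      L * |x - y| * (digitProb N k y * ((N : ℝ) / (N + 1) ^ 2) +
      if k = 0 then digitProb N 0 y * (1 / (N : ℝ) - N / (N + 1) ^ 2) else 0) := by
    intro k
    have e1 := hf _ (branch_mem hN hx k) _ (branch_mem hN hy k)
    rw [branch_sub_branch hN hx hy] at e1
    have e2 := digitProb_nonneg (N := N) hy k
    rw [norm_mul, Real.norm_of_nonneg e2, Real.norm_eq_abs]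
    calc _ ≤ digitProb N k y * (L * (N / ((x + N + k) * (y + N + k)) * |x - y|)) := by gcongr
      _ = L * |x - y| * (digitProb N k y * (N / ((x + N + k) * (y + N + k)))) := by ring
      _ ≤ _ := by
        gcongr
        exact digitProb_mul_le_weight hN hx hy k
  have s1 : Summable fun k => D (k + 1) * (F (k + 1) - F k) := hG1.summable.of_norm_bounded b1
  have s2 : Summable fun k => digitProb N k y * (F k - f (branch N k y)) :=
    hG2.summable.of_norm_bounded b2
  have sx := summable_transfer hN hf hx
  have sy := summable_transfer hN hf hy
  -- Abel summation: the change of weights is `D k - D (k + 1)`, which moves the differences onto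
  -- consecutive values of `F`. The last term keeps the weights at `y` and moves only the branch
  -- point.
  have key : ∀ k, digitProb N k x * f (branch N k x) - digitProb N k y * f (branch N k y) =
      (D k * F k - D (k + 1) * F (k + 1)) + D (k + 1) * (F (k + 1) - F k) +
        digitProb N k y * (F k - f (branch N k y)) := by
    intro k
    rw [digitProb_eq_tail_sub hN hx, digitProb_eq_tail_sub hN hy]
    simp only [hD, hF]
    ring
  -- The telescoping part is summable because every other term of `key` is.
  have s3 : Summable fun k => D k * F k - D (k + 1) * F (k + 1) := by
    refine (((sx.sub sy).sub s1).sub s2).congr fun k => ?_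
    rw [key]; ring
  have hDlim : Tendsto D atTop (𝓝 0) := by
    simpa using (tendsto_digitTail (N := N) (t := x)).sub (tendsto_digitTail (N := N) (t := y))
  have hDF : Tendsto (fun k => D k * F k) atTop (𝓝 0) := by
    refine squeeze_zero_norm (a := fun k => |D k| * (|f 0| + L)) (fun k => ?_) ?_
    · rw [norm_mul, Real.norm_eq_abs, Real.norm_eq_abs]
      exact mul_le_mul_of_nonneg_left (hf.abs_le (branch_mem hN hx k)) (abs_nonneg _)
    · simpa using hDlim.abs.mul_const (|f 0| + L)
  have t3 := (hasSum_telescope (u := fun k => D k * F k) s3 hDF).tsum_eq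
  have hD0 : D 0 = 0 := by simp [hD, digitTail_zero hN hx, digitTail_zero hN hy]
  rw [hD0, zero_mul, sub_zero] at t3
  have hU : NCF.transfer N f x - NCF.transfer N f y =
      ∑' k, D (k + 1) * (F (k + 1) - F k) + ∑' k, digitProb N k y * (F k - f (branch N k y)) := by
    unfold NCF.transfer
    rw [← sx.tsum_sub sy, tsum_congr key, (s3.add s1).tsum_add s2, s3.tsum_add s1, t3, zero_add]
  rw [hU]
  refine (abs_add_le _ _).trans ?_
  have n1 := tsum_of_norm_bounded hG1 b1
  have n2 := tsum_of_norm_bounded hG2 b2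
  rw [Real.norm_eq_abs] at n1 n2
  refine (add_le_add n1 n2).trans ?_
  rw [← mul_add, mul_right_comm L (7 / 8)]
  exact mul_le_mul_of_nonneg_left (contraction_constant hN hy) (by positivity)

/-! ### The map on the real line and its cylinders. -/

/-- The `N`-continued fraction map on the real line. -/
noncomputable def realMap (N : ℕ) (x : ℝ) : ℝ := Int.fract ((N : ℝ) / x)

theorem measurable_realMap (N : ℕ) : Measurable (realMap N) :=
  (measurable_const.div measurable_id).fract

theorem realMap_branch {N : ℕ} (hN : 1 ≤ N) (k : ℕ) {t : ℝ} (ht : t ∈ Set.Ico (0 : ℝ) 1) :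
    realMap N (branch N k t) = t := by
  have h0 : (N : ℝ) ≠ 0 := by positivity
  unfold realMap branch
  rw [div_div_cancel₀ h0, add_assoc, ← Nat.cast_add, Int.fract_add_natCast]
  exact Int.fract_eq_self.2 ht

/-- The cylinder of the digit `N + k`. -/
def cylinder (N k : ℕ) : Set ℝ := {x | x ∈ Set.Ioc (0 : ℝ) 1 ∧ ⌊(N : ℝ) / x⌋ = ((N + k : ℕ) : ℤ)}

/-- The half-open interval matches the floor exactly, so the images are disjoint and tile `(0, 1]`
with no exceptional endpoints. -/
theorem branch_image {N : ℕ} (hN : 1 ≤ N) (k : ℕ) :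
    branch N k '' Set.Ico 0 1 = cylinder N k := by
  have h0 : (1 : ℝ) ≤ N := by exact_mod_cast hN
  have h1 : (N : ℝ) ≠ 0 := by positivity
  ext x
  constructor
  · rintro ⟨t, ht, rfl⟩
    have ht0 := ht.1
    refine ⟨⟨?_, (branch_mem hN ht.1 k).2⟩, ?_⟩
    · unfold branch; positivity
    · unfold branch
      rw [div_div_cancel₀ h1, Int.floor_eq_iff]
      push_cast
      constructor <;> linarith [ht.1, ht.2]
  · rintro ⟨⟨hx, -⟩, hk⟩
    rw [Int.floor_eq_iff] at hk
    push_cast at hk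
    refine ⟨N / x - (N + k), ⟨by linarith, by linarith⟩, ?_⟩
    unfold branch
    have : (N : ℝ) / x - (N + k) + N + k = N / x := by ring
    rw [this, div_div_cancel₀ h1]

theorem measurableSet_cylinder (N k : ℕ) : MeasurableSet (cylinder N k) := by
  have h : Measurable fun x : ℝ => ⌊(N : ℝ) / x⌋ := (measurable_const.div measurable_id).floor
  exact measurableSet_Ioc.inter (h (measurableSet_singleton _))

theorem disjoint_cylinder (N : ℕ) : Pairwise (Function.onFun Disjoint (cylinder N)) := by
  intro i j hij
  refine Set.disjoint_left.2 fun x hi hj => hij ?_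
  have := hi.2.symm.trans hj.2
  omega

theorem iUnion_cylinder {N : ℕ} (hN : 1 ≤ N) : ⋃ k, cylinder N k = Set.Ioc 0 1 := by
  have h0 : (1 : ℝ) ≤ N := by exact_mod_cast hN
  ext x
  simp only [Set.mem_iUnion]
  refine ⟨fun ⟨k, hk⟩ => hk.1, fun hx => ?_⟩
  have h1 : (N : ℤ) ≤ ⌊(N : ℝ) / x⌋ := by
    rw [Int.le_floor]
    push_cast
    rw [le_div_iff₀ hx.1]
    nlinarith [hx.2]
  refine ⟨(⌊(N : ℝ) / x⌋ - N).toNat, hx, ?_⟩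
  push_cast
  rw [Int.toNat_of_nonneg (by omega)]
  ring

theorem hasDerivAt_branch {N : ℕ} (hN : 1 ≤ N) (k : ℕ) {t : ℝ} (ht : 0 ≤ t) :
    HasDerivAt (branch N k) (-(N / (t + N + k) ^ 2)) t := by
  have h0 : (1 : ℝ) ≤ N := by exact_mod_cast hN
  have h1 : t + N + k ≠ 0 := by positivity
  have h := (((hasDerivAt_id t).add_const (N : ℝ)).add_const (k : ℝ)).fun_inv h1
  have h2 := h.const_mul (N : ℝ)
  have h3 : branch N k = fun y : ℝ => (N : ℝ) * (id y + N + k)⁻¹ := by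
    funext y
    exact div_eq_mul_inv _ _
  rw [h3, show -((N : ℝ) / (t + N + k) ^ 2) = N * (-1 / (id t + N + k) ^ 2) by
    simp only [id]; ring]
  exact h2

theorem injOn_branch {N : ℕ} (hN : 1 ≤ N) (k : ℕ) : Set.InjOn (branch N k) (Set.Ico 0 1) := by
  intro x hx y hy h
  rw [← realMap_branch hN k hx, ← realMap_branch hN k hy, h]

theorem restrict_Ico_eq_Ioc :
    (volume : Measure ℝ).restrict (Set.Ico 0 1) = volume.restrict (Set.Ioc 0 1) :=
  Measure.restrict_congr_set Ico_ae_eq_Ioc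

/-! ### Duality between the map and the transfer operator. -/

theorem LipUnit.aestronglyMeasurable {L : ℝ} {f : ℝ → ℝ} (hf : LipUnit L f) :
    AEStronglyMeasurable f (volume.restrict (Set.Ioc 0 1)) :=
  (hf.continuousOn.mono Set.Ioc_subset_Icc_self).aestronglyMeasurable measurableSet_Ioc

theorem integrableOn_mul {N : ℕ} (hN : 1 ≤ N) {L C : ℝ} {f ψ : ℝ → ℝ} (hf : LipUnit L f)
    (hψ : Measurable ψ) (hC : ∀ x, |ψ x| ≤ C) :
    IntegrableOn (fun x => f x / (x + N) * ψ x) (Set.Ioc 0 1) := by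
  have h0 : (1 : ℝ) ≤ N := by exact_mod_cast hN
  refine Integrable.of_bound
    ((hf.aestronglyMeasurable.aemeasurable.div
      (measurable_id.add_const _).aemeasurable).mul hψ.aemeasurable).aestronglyMeasurable ((|f 0| + L) * C) ?_
  refine (ae_restrict_iff' measurableSet_Ioc).2 (ae_of_all _ fun x hx => ?_)
  rw [norm_mul]
  have h2 := hf.abs_le ⟨hx.1.le, hx.2⟩
  have h1 : ‖f x / (x + N)‖ ≤ |f 0| + L := by
    rw [Real.norm_eq_abs, abs_div, abs_of_nonneg (a := x + N) (by linarith [hx.1])]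
    exact (div_le_self (abs_nonneg _) (by linarith [hx.1])).trans h2
  exact mul_le_mul h1 (hC x) (norm_nonneg _) ((norm_nonneg _).trans h1)

/-- Duality between the map and its transfer operator. -/
theorem integral_comp_realMap {N : ℕ} (hN : 1 ≤ N) {L C : ℝ} {f ψ : ℝ → ℝ} (hf : LipUnit L f)
    (hψ : Measurable ψ) (hC : ∀ x, |ψ x| ≤ C) :
    ∫ x in Set.Ioc 0 1, f x / (x + N) * ψ (realMap N x) =
      ∫ t in Set.Ioc 0 1, transfer N f t / (t + N) * ψ t := by
  have h0 : (1 : ℝ) ≤ N := by exact_mod_cast hN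
  have hC0 : 0 ≤ C := (abs_nonneg _).trans (hC 0)
  have hint : IntegrableOn (fun x => f x / (x + N) * ψ (realMap N x)) (⋃ k, cylinder N k) := by
    rw [iUnion_cylinder hN]
    exact integrableOn_mul hN hf (hψ.comp (measurable_realMap N)) fun x => hC _
  have h1 := hasSum_integral_iUnion (measurableSet_cylinder N) (disjoint_cylinder N) hint
  rw [iUnion_cylinder hN] at h1
  have h2 : ∀ k, ∫ x in cylinder N k, f x / (x + N) * ψ (realMap N x) =
      ∫ t in Set.Ioc 0 1, digitProb N k t * f (branch N k t) / (t + N) * ψ t := by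
    intro k
    rw [← branch_image hN, integral_image_eq_integral_abs_deriv_smul measurableSet_Ico
      (fun t ht => (hasDerivAt_branch hN k ht.1).hasDerivWithinAt) (injOn_branch hN k),
      ← restrict_Ico_eq_Ioc]
    refine setIntegral_congr_fun measurableSet_Ico fun t ht => ?_
    have ht0 := ht.1
    simp only [smul_eq_mul]
    rw [realMap_branch hN k ht, abs_neg, abs_of_nonneg (by positivity)]
    have e1 : t + N + k ≠ 0 := by positivity
    have e2 : t + N + k + 1 ≠ 0 := by positivity
    have e3 : t + N ≠ 0 := by positivity
    -- Hence the Jacobian `N / (t + N + k) ^ 2` divided by `branch N k t + N` is exactly `digitProb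
    -- N k t / (t + N)`.
    have e4 : branch N k t + N = N * (t + N + k + 1) / (t + N + k) := by
      unfold branch
      field_simp
      ring
    rw [e4]
    unfold digitProb
    field_simp
  simp only [h2] at h1
  -- Sum and integral are exchanged by dominated convergence; as the probabilities sum to 1, the
  -- dominating series has a constant sum.
  refine h1.unique (hasSum_integral_of_dominated_convergence
    (fun k t => digitProb N k t * ((|f 0| + L) * C)) ?_ ?_ ?_ ?_ ?_)
  · intro k
    have hb : ContinuousOn (branch N k) (Set.Ioc 0 1) := fun t ht =>
      (hasDerivAt_branch hN k ht.1.le).continuousAt.continuousWithinAt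
    have hfb : AEStronglyMeasurable (fun t => f (branch N k t)) (volume.restrict (Set.Ioc 0 1)) :=
      (hf.continuousOn.comp hb fun t ht => branch_mem hN ht.1.le k).aestronglyMeasurable
        measurableSet_Ioc
    have hp : Measurable (digitProb N k) := by unfold digitProb; fun_prop
    exact (((hp.aemeasurable.mul hfb.aemeasurable).div
      (measurable_id.add_const _).aemeasurable).mul hψ.aemeasurable).aestronglyMeasurable
  · intro k
    refine (ae_restrict_iff' measurableSet_Ioc).2 (ae_of_all _ fun t ht => ?_)
    have e1 := digitProb_nonneg (N := N) ht.1.le k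
    have e2 := hf.abs_le (branch_mem hN ht.1.le k)
    rw [norm_mul, norm_div, norm_mul, Real.norm_of_nonneg e1,
      Real.norm_of_nonneg (r := t + N) (by linarith [ht.1]), ← mul_assoc]
    refine mul_le_mul ((div_le_self (by positivity) (by linarith [ht.1])).trans ?_) (hC t)
      (norm_nonneg _) (mul_nonneg e1 ((abs_nonneg _).trans e2))
    exact mul_le_mul_of_nonneg_left e2 e1
  · refine (ae_restrict_iff' measurableSet_Ioc).2 (ae_of_all _ fun t ht => ?_)
    exact (hasSum_digitProb hN ht.1.le).summable.mul_right _
  · refine IntegrableOn.congr_fun (f := fun _ => (|f 0| + L) * C)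
      (integrableOn_const (by simp)) (fun t ht => ?_)
      measurableSet_Ioc
    rw [tsum_mul_right, (hasSum_digitProb hN ht.1.le).tsum_eq, one_mul]
  · refine (ae_restrict_iff' measurableSet_Ioc).2 (ae_of_all _ fun t ht => ?_)
    exact (((summable_transfer hN hf ht.1.le).hasSum).div_const _).mul_right _

theorem LipUnit.transfer_iterate {N : ℕ} (hN : 1 ≤ N) {L : ℝ} {f : ℝ → ℝ} (hf : LipUnit L f)
    (n : ℕ) : LipUnit (L * (7 / 8) ^ n) ((NCF.transfer N)^[n] f) := by
  induction n with
  | zero => simpa using hf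
  | succ n ih =>
    rw [Function.iterate_succ_apply', pow_succ, ← mul_assoc]
    exact ih.transfer hN

theorem integral_comp_realMap_iterate {N : ℕ} (hN : 1 ≤ N) {L C : ℝ} {f ψ : ℝ → ℝ}
    (hf : LipUnit L f) (hψ : Measurable ψ) (hC : ∀ x, |ψ x| ≤ C) (n : ℕ) :
    ∫ x in Set.Ioc 0 1, f x / (x + N) * ψ ((realMap N)^[n] x) =
      ∫ t in Set.Ioc 0 1, (transfer N)^[n] f t / (t + N) * ψ t := by
  induction n generalizing L f with
  | zero => rfl
  | succ n ih =>
    simp only [Function.iterate_succ_apply]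
    rw [← ih (hf.transfer hN)]
    exact integral_comp_realMap hN hf (hψ.comp ((measurable_realMap N).iterate n)) fun x => hC _

/-! ### The estimate for Lipschitz weights. -/

theorem setIntegral_inv_add {N : ℕ} (hN : 1 ≤ N) {x : ℝ} (hx : 0 ≤ x) :
    ∫ t in Set.Ioc 0 x, 1 / (t + N) = Real.log ((x + N) / N) := by
  have h0 : (1 : ℝ) ≤ N := by exact_mod_cast hN
  rw [← intervalIntegral.integral_of_le hx,
    intervalIntegral.integral_comp_add_right (fun t : ℝ => 1 / t) (N : ℝ), zero_add,
    integral_one_div_of_pos (by positivity) (by positivity)]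

theorem abs_setIntegral_sub_le {N : ℕ} (hN : 1 ≤ N) {M c x : ℝ} {f : ℝ → ℝ}
    (hx : x ∈ Set.Icc (0 : ℝ) 1) (hi : IntegrableOn (fun t => f t / (t + N)) (Set.Ioc 0 1))
    (hb : ∀ t ∈ Set.Icc (0 : ℝ) 1, |f t - c| ≤ M) :
    |(∫ t in Set.Ioc 0 x, f t / (t + N)) - c * Real.log ((x + N) / N)| ≤
      M * Real.log ((x + N) / N) := by
  have h0 : (1 : ℝ) ≤ N := by exact_mod_cast hN
  have hsub : Set.Ioc 0 x ⊆ Set.Ioc (0 : ℝ) 1 := Set.Ioc_subset_Ioc_right hx.2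
  have hi2 : IntegrableOn (fun t : ℝ => 1 / (t + N)) (Set.Ioc 0 x) := by
    refine (ContinuousOn.integrableOn_Icc (a := 0) (b := x) ?_).mono_set Set.Ioc_subset_Icc_self
    refine ContinuousOn.div continuousOn_const (by fun_prop) fun t ht => ?_
    linarith [ht.1]
  rw [← setIntegral_inv_add hN hx.1, ← integral_const_mul, ← integral_const_mul,
    ← integral_sub (hi.mono_set hsub) (hi2.const_mul c), ← Real.norm_eq_abs]
  refine norm_integral_le_of_norm_le (hi2.const_mul M) ?_
  refine (ae_restrict_iff' measurableSet_Ioc).2 (ae_of_all _ fun t ht => ?_)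
  have ht1 := hsub ht
  have hp : (0 : ℝ) < t + N := by linarith [ht1.1]
  have := hb t ⟨ht1.1.le, ht1.2⟩
  rw [show f t / (t + N) - c * (1 / (t + N)) = (f t - c) * (1 / (t + N)) by ring, norm_mul,
    Real.norm_of_nonneg (r := 1 / (t + N)) (by positivity)]
  exact mul_le_mul_of_nonneg_right this (by positivity)

theorem log_ratio_pos {N : ℕ} (hN : 1 ≤ N) {x : ℝ} (hx : 0 < x) :
    0 < Real.log ((x + N) / N) := by
  have h0 : (1 : ℝ) ≤ N := by exact_mod_cast hN
  refine Real.log_pos ?_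
  rw [one_lt_div (by positivity)]
  linarith

/-- The Gauss–Kuzmin estimate for a weight whose density is Lipschitz. -/
theorem abs_setIntegral_realMap_lt_sub_le {N : ℕ} (hN : 1 ≤ N) {L : ℝ} {f : ℝ → ℝ}
    (hf : LipUnit L f) (n : ℕ) {x : ℝ} (hx : x ∈ Set.Icc (0 : ℝ) 1) :
    |(∫ t in {y | (realMap N)^[n] y < x} ∩ Set.Ioc 0 1, f t / (t + N)) -
      (∫ t in Set.Ioc 0 1, f t / (t + N)) / Real.log ((1 + N) / N) * Real.log ((x + N) / N)| ≤
      L * (7 / 8) ^ n * Real.log ((x + N) / N) := by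
  have h0 : (1 : ℝ) ≤ N := by exact_mod_cast hN
  set g := (transfer N)^[n] f with hg
  have hgL := hf.transfer_iterate hN n
  rw [← hg] at hgL
  set I := ∫ t in Set.Ioc 0 1, f t / (t + N) with hI
  set ℓ := Real.log ((1 + N) / N) with hℓ
  have hℓ0 : 0 < ℓ := log_ratio_pos hN one_pos
  have hgi : IntegrableOn (fun t => g t / (t + N)) (Set.Ioc 0 1) := by
    simpa using integrableOn_mul hN hgL (measurable_const (a := (1 : ℝ))) (C := 1) (by simp)
  have hmean : ∫ t in Set.Ioc 0 1, g t / (t + N) = I := by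
    have := integral_comp_realMap_iterate hN hf (measurable_const (a := (1 : ℝ))) (C := 1)
      (by simp) n
    simpa using this.symm
  have hosc : ∀ t ∈ Set.Icc (0 : ℝ) 1, |g t - I / ℓ| ≤ L * (7 / 8) ^ n := by
    intro t ht
    -- Comparing `g` with its own value `g t` over all of `(0, 1]` bounds the distance from `g t` to
    -- the mean `I / ℓ`.
    have h1 := abs_setIntegral_sub_le hN (x := 1) (c := g t) (M := L * (7 / 8) ^ n) (by simp) hgi
      fun s hs => by
        refine (hgL s hs t ht).trans (mul_le_of_le_one_right hgL.nonneg ?_)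
        rw [abs_le]
        constructor <;> linarith [hs.1, hs.2, ht.1, ht.2]
    rw [hmean, ← hℓ, abs_sub_comm] at h1
    have h2 : g t - I / ℓ = (g t * ℓ - I) / ℓ := by field_simp
    rw [h2, abs_div, abs_of_pos hℓ0, div_le_iff₀ hℓ0]
    exact h1
  have hS : MeasurableSet {y | (realMap N)^[n] y < x} :=
    measurableSet_lt ((measurable_realMap N).iterate n) measurable_const
  have hdual := integral_comp_realMap_iterate hN hf
    (ψ := (Set.Iio x).indicator 1) (C := 1) (measurable_one.indicator measurableSet_Iio)
    (fun y => by by_cases h : y ∈ Set.Iio x <;> simp [h]) n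
  have e1 : ∫ t in {y | (realMap N)^[n] y < x} ∩ Set.Ioc 0 1, f t / (t + N) =
      ∫ t in Set.Ioc 0 1, f t / (t + N) * (Set.Iio x).indicator (1 : ℝ → ℝ) ((realMap N)^[n] t) := by
    rw [Set.inter_comm, ← setIntegral_indicator hS]
    refine integral_congr_ae (ae_of_all _ fun t => ?_)
    by_cases h : (realMap N)^[n] t < x <;> simp [h]
  have e2 : ∫ t in Set.Ioc 0 1, g t / (t + N) * (Set.Iio x).indicator (1 : ℝ → ℝ) t =
      ∫ t in Set.Ioc 0 x, g t / (t + N) := by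
    have h1 : (Set.Ioc 0 1 ∩ Set.Iio x : Set ℝ) =ᵐ[volume] (Set.Ioc 0 x : Set ℝ) := by
      have : Set.Ioc (0 : ℝ) 1 ∩ Set.Iio x = Set.Ioo 0 x := by
        ext t
        simp only [Set.mem_inter_iff, Set.mem_Ioc, Set.mem_Iio, Set.mem_Ioo]
        exact ⟨fun h => ⟨h.1.1, h.2⟩, fun h => ⟨⟨h.1, h.2.le.trans hx.2⟩, h.2⟩⟩
      rw [this]
      exact Ioo_ae_eq_Ioc
    rw [← setIntegral_congr_set h1, ← setIntegral_indicator measurableSet_Iio]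
    refine integral_congr_ae (ae_of_all _ fun t => ?_)
    by_cases h : t < x <;> simp [h]
  rw [e1, hdual, ← hg, e2]
  exact abs_setIntegral_sub_le hN hx hgi hosc

/-! ### From the unit interval to the real line. -/

/-- At `0` the convention `N / 0 = 0` gives fractional part `0`, the value prescribed for `T`. -/
theorem coe_T (N : ℕ) (y : unitInterval) : (T N y : ℝ) = realMap N y := by
  unfold T realMap
  split_ifs with h
  · simp [h]
  · rfl

theorem coe_T_iterate (N n : ℕ) (y : unitInterval) :
    ((T N)^[n] y : ℝ) = (realMap N)^[n] y := by
  induction n with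
  | zero => rfl
  | succ n ih => rw [Function.iterate_succ_apply', Function.iterate_succ_apply', coe_T, ih]

theorem measurableSet_realMap_lt (N n : ℕ) (x : ℝ) :
    MeasurableSet {y | (realMap N)^[n] y < x} :=
  measurableSet_lt ((measurable_realMap N).iterate n) measurable_const

theorem distrib_eq_map (N : ℕ) (μ : Measure unitInterval) (n : ℕ) (x : unitInterval) :
    distrib N μ n x = (μ.map ((↑) : unitInterval → ℝ)).real {y | (realMap N)^[n] y < x} := by
  unfold distrib
  rw [map_measureReal_apply measurable_subtype_coe (measurableSet_realMap_lt N n x)]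
  congr 1
  ext y
  simp only [Set.mem_ofPred_eq, Set.mem_preimage, ← Subtype.coe_lt_coe, coe_T_iterate]

/-- An absolutely continuous probability measure on `[0, 1]` is given by integration of an
integrable density over `(0, 1]`. -/
theorem exists_integrableOn_density {μ : Measure unitInterval} [IsProbabilityMeasure μ]
    (hμ : μ ≪ volume) : ∃ k : ℝ → ℝ, IntegrableOn k (Set.Ioc 0 1) ∧
      ∀ S : Set ℝ, MeasurableSet S →
        (μ.map ((↑) : unitInterval → ℝ)).real S = ∫ t in S ∩ Set.Ioc 0 1, k t := by
  set ν := μ.map ((↑) : unitInterval → ℝ) with hν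
  have hac : ν ≪ volume.restrict (Set.Ioc 0 1) := by
    have h := hμ.map measurable_subtype_coe
    rw [unitInterval.measurePreserving_coe.map_eq] at h
    rwa [Measure.restrict_congr_set (Ioc_ae_eq_Icc (a := (0 : ℝ)) (b := 1))]
  have : IsProbabilityMeasure ν := Measure.isProbabilityMeasure_map (by fun_prop)
  -- The Radon–Nikodym derivative serves as density, so only absolute continuity is needed.
  refine ⟨fun t => (ν.rnDeriv (volume.restrict (Set.Ioc 0 1)) t).toReal,
    Measure.integrable_toReal_rnDeriv, fun S hS => ?_⟩
  rw [← Measure.restrict_restrict hS, Measure.setIntegral_toReal_rnDeriv hac]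

/-- Here the given density must itself be the integrand, since its Lipschitz bound is what the rate
in (ii) uses. -/
theorem measureReal_map_eq_setIntegral {μ : Measure unitInterval} {h : unitInterval → ℝ}
    (hd : HasDensity μ h) (hc : Continuous h) {S : Set ℝ} (hS : MeasurableSet S) :
    (μ.map ((↑) : unitInterval → ℝ)).real S =
      ∫ t in S ∩ Set.Ioc 0 1, Set.IccExtend (zero_le_one' ℝ) h t := by
  have hS' : MeasurableSet (((↑) : unitInterval → ℝ) ⁻¹' S) := measurable_subtype_coe hS
  have e : ∀ y : unitInterval, Set.IccExtend (zero_le_one' ℝ) h y = h y :=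
    fun y => Set.IccExtend_val _ _ y
  rw [map_measureReal_apply measurable_subtype_coe hS, Measure.real, hd.2,
    withDensity_apply _ hS', ← integral_eq_lintegral_of_nonneg_ae (ae_of_all _ hd.1)
      hc.aestronglyMeasurable]
  simp_rw [← e]
  rw [(unitInterval.measurePreserving_coe.restrict_preimage hS).integral_comp
    unitInterval.measurableEmbedding_coe, Measure.restrict_restrict hS]
  refine setIntegral_congr_set ?_
  exact (ae_eq_refl S).inter Ioc_ae_eq_Icc.symm

/-- Passes from a Lebesgue density to one relative to `dx / (x + N)`. -/
theorem LipUnit.mul_add {L : ℝ} {f : ℝ → ℝ} (hf : LipUnit L f) (N : ℕ) :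
    LipUnit (L * (1 + N) + (|f 0| + L)) fun t => f t * (t + N) := by
  intro x hx y hy
  have h1 := hf x hx y hy
  have h2 := hf.abs_le hy
  have h3 : f x * (x + N) - f y * (y + N) = (f x - f y) * (x + N) + f y * (x - y) := by ring
  rw [h3]
  refine (abs_add_le _ _).trans ?_
  rw [abs_mul, abs_mul, abs_of_nonneg (a := x + N) (by have := hx.1; positivity)]
  have h4 : |f x - f y| * (x + N) ≤ L * |x - y| * (1 + N) := by
    have := hx.1
    gcongr
    · exact mul_nonneg hf.nonneg (abs_nonneg _)
    · exact hx.2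
  have h5 : |f y| * |x - y| ≤ (|f 0| + L) * |x - y| := by gcongr
  linarith

/-- The Gauss–Kuzmin estimate for a Lipschitz density. -/
theorem LipUnit.abs_setIntegral_sub_le {N : ℕ} (hN : 1 ≤ N) {L : ℝ} {g : ℝ → ℝ}
    (hg : LipUnit L g) : ∃ M, 0 ≤ M ∧ ∀ n : ℕ, ∀ x ∈ Set.Icc (0 : ℝ) 1,
      |(∫ t in {y | (realMap N)^[n] y < x} ∩ Set.Ioc 0 1, g t) -
        (∫ t in Set.Ioc 0 1, g t) / Real.log ((1 + N) / N) * Real.log ((x + N) / N)| ≤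
      M * (7 / 8) ^ n * Real.log ((x + N) / N) := by
  have h0 : (1 : ℝ) ≤ N := by exact_mod_cast hN
  have hf := hg.mul_add N
  refine ⟨_, hf.nonneg, fun n x hx => ?_⟩
  have h := abs_setIntegral_realMap_lt_sub_le hN hf n hx
  have e : ∀ S : Set ℝ, MeasurableSet S → S ⊆ Set.Ioc 0 1 →
      ∫ t in S, g t * (t + N) / (t + N) = ∫ t in S, g t := fun S hS hS1 =>
    setIntegral_congr_fun hS fun t ht => by
      have := (hS1 ht).1
      exact mul_div_cancel_right₀ _ (by positivity)
  rwa [e _ ((measurableSet_realMap_lt N n x).inter measurableSet_Ioc) Set.inter_subset_right,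
    e _ measurableSet_Ioc subset_rfl] at h

/-! ### Approximation in `L¹` and the limit. -/

theorem exists_lipUnit_of_contDiff {f : ℝ → ℝ} (hf : ContDiff ℝ 1 f) : ∃ L, LipUnit L f := by
  obtain ⟨C, hC⟩ := (isCompact_Icc (a := (0 : ℝ)) (b := 1)).exists_bound_of_continuousOn
    (hf.continuous_deriv le_rfl).continuousOn
  exact ⟨C, fun x hx y hy => (convex_Icc (0 : ℝ) 1).norm_image_sub_le_of_norm_deriv_le
    (fun z _ => hf.differentiable one_ne_zero z) hC hy hx⟩

/-- Continuous functions are dense in `L¹`, and Weierstrass approximation makes them polynomials;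
each step costs `ε / 2` on an interval of length 1. -/
theorem exists_lipUnit_approx {k : ℝ → ℝ} (hk : IntegrableOn k (Set.Ioc 0 1)) {ε : ℝ}
    (hε : 0 < ε) : ∃ g : ℝ → ℝ, ∃ L, LipUnit L g ∧ IntegrableOn g (Set.Ioc 0 1) ∧
      ∫ t in Set.Ioc 0 1, ‖k t - g t‖ ≤ ε := by
  obtain ⟨c, hc, hci⟩ := Integrable.exists_boundedContinuous_integral_sub_le hk (half_pos hε)
  obtain ⟨p, hp⟩ := exists_polynomial_near_of_continuousOn 0 1 c c.continuous.continuousOn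
    (ε / 2) (half_pos hε)
  obtain ⟨L, hL⟩ := exists_lipUnit_of_contDiff (f := fun t => p.eval t)
    (by simpa using p.contDiff_aeval (𝕜 := ℝ) 1)
  have hpi : IntegrableOn (fun t => p.eval t) (Set.Ioc (0 : ℝ) 1) :=
    (p.continuous.continuousOn.integrableOn_Icc).mono_set Set.Ioc_subset_Icc_self
  refine ⟨_, L, hL, hpi, ?_⟩
  have h1 : ∫ t in Set.Ioc 0 1, ‖k t - p.eval t‖ ≤
      ∫ t in Set.Ioc 0 1, (‖k t - c t‖ + ε / 2) := by
    have hk' : Integrable k (volume.restrict (Set.Ioc 0 1)) := hk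
    refine setIntegral_mono_on (hk'.sub hpi).norm
      ((hk'.sub hci).norm.add (integrable_const _)) measurableSet_Ioc fun t ht => ?_
    have h2 := hp t ⟨ht.1.le, ht.2⟩
    have h3 : k t - p.eval t = (k t - c t) - (p.eval t - c t) := by ring
    rw [h3]
    exact (norm_sub_le _ _).trans (add_le_add_right h2.le _)
  have h4 : ∫ t in Set.Ioc 0 1, (‖k t - c t‖ + ε / 2) =
      (∫ t in Set.Ioc 0 1, ‖k t - c t‖) + ε / 2 := by
    have hi : Integrable (fun t => ‖k t - c t‖) (volume.restrict (Set.Ioc 0 1)) :=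
      Integrable.norm (Integrable.sub hk hci)
    rw [integral_add hi (integrable_const _)]
    simp
  linarith

theorem log_ratio_nonneg {N : ℕ} (hN : 1 ≤ N) {x : ℝ} (hx : 0 ≤ x) :
    0 ≤ Real.log ((x + N) / N) := by
  rcases hx.eq_or_lt with rfl | h
  · have : (N : ℝ) ≠ 0 := by positivity
    simp [this]
  · exact (log_ratio_pos hN h).le

theorem log_ratio_le {N : ℕ} (hN : 1 ≤ N) {x : ℝ} (hx : x ∈ Set.Icc (0 : ℝ) 1) :
    Real.log ((x + N) / N) ≤ Real.log ((1 + N) / N) := by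
  have h0 : (1 : ℝ) ≤ N := by exact_mod_cast hN
  have := hx.1
  have := hx.2
  exact Real.log_le_log (by positivity) (by gcongr)

/-- The Gauss–Kuzmin limit for an integrable density. -/
theorem tendsto_setIntegral_realMap_lt {N : ℕ} (hN : 1 ≤ N) {k : ℝ → ℝ}
    (hk : IntegrableOn k (Set.Ioc 0 1)) {x : ℝ} (hx : x ∈ Set.Icc (0 : ℝ) 1) :
    Tendsto (fun n : ℕ => ∫ t in {y | (realMap N)^[n] y < x} ∩ Set.Ioc 0 1, k t) atTop
      (𝓝 ((∫ t in Set.Ioc 0 1, k t) / Real.log ((1 + N) / N) * Real.log ((x + N) / N))) := by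
  rw [Metric.tendsto_atTop]
  intro ε hε
  obtain ⟨g, L, hg, hgi, hkg⟩ := exists_lipUnit_approx hk (ε := ε / 4) (by positivity)
  obtain ⟨M, hM, hb⟩ := hg.abs_setIntegral_sub_le hN
  set ℓ := Real.log ((1 + N) / N) with hℓ
  have hℓ0 : 0 < ℓ := log_ratio_pos hN one_pos
  set r := Real.log ((x + N) / N) with hr
  have hr0 : 0 ≤ r := log_ratio_nonneg hN hx.1
  have hrℓ : r ≤ ℓ := log_ratio_le hN hx
  have hlim : Tendsto (fun n : ℕ => M * (7 / 8 : ℝ) ^ n * r) atTop (𝓝 0) := by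
    simpa using ((tendsto_pow_atTop_nhds_zero_of_lt_one (by norm_num)
      (by norm_num : (7 / 8 : ℝ) < 1)).const_mul M).mul_const r
  obtain ⟨n₀, hn₀⟩ := eventually_atTop.1 (hlim.eventually_lt_const (half_pos hε))
  refine ⟨n₀, fun n hn => ?_⟩
  -- The bound holds for every `S` at once, hence for the events of all `n`. The errors add up to `ε
  -- / 4 + ε / 2 + ε / 4`.
  have hdiff : ∀ S ⊆ Set.Ioc (0 : ℝ) 1, |(∫ t in S, k t) - ∫ t in S, g t| ≤ ε / 4 := by
    intro S hS
    rw [← integral_sub (hk.mono_set hS) (hgi.mono_set hS), ← Real.norm_eq_abs]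
    refine (norm_integral_le_integral_norm _).trans (le_trans ?_ hkg)
    exact setIntegral_mono_set (Integrable.norm (Integrable.sub hk hgi))
      (ae_of_all _ fun t => norm_nonneg _) hS.eventuallyLE
  have d1 := hdiff _ (Set.inter_subset_right (s := {y | (realMap N)^[n] y < x}))
  have d2 := hdiff _ subset_rfl
  have d3 := (hb n x hx).trans_lt (hn₀ n hn)
  set K := ∫ t in Set.Ioc 0 1, k t
  set G := ∫ t in Set.Ioc 0 1, g t
  have d4 : |G / ℓ * r - K / ℓ * r| ≤ ε / 4 := by
    have : G / ℓ * r - K / ℓ * r = (G - K) * (r / ℓ) := by ring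
    rw [this, abs_mul, abs_sub_comm, abs_of_nonneg (a := r / ℓ) (by positivity)]
    exact (mul_le_of_le_one_right (abs_nonneg _) ((div_le_one hℓ0).2 hrℓ)).trans d2
  rw [Real.dist_eq]
  rw [abs_le] at d1 d4
  rw [abs_lt] at d3 ⊢
  constructor <;> linarith [d1.1, d1.2, d3.1, d3.2, d4.1, d4.2]

theorem lipUnit_IccExtend {h : unitInterval → ℝ} {K : NNReal} (hK : LipschitzWith K h) :
    LipUnit K (Set.IccExtend (zero_le_one' ℝ) h) := by
  intro x hx y hy
  rw [Set.IccExtend_of_mem _ _ hx, Set.IccExtend_of_mem _ _ hy]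
  exact hK.dist_le_mul ⟨x, hx⟩ ⟨y, hy⟩

end NCF

/-! ### The theorem. -/

theorem theorem1 (N : ℕ) (hN : 1 ≤ N) :
    (∀ μ : Measure unitInterval, IsProbabilityMeasure μ → NCF.AssumptionA μ →
      ∀ x : unitInterval,
        Tendsto (fun n : ℕ => NCF.distrib N μ n x) atTop
          (𝓝 (1 / Real.log (((N : ℝ) + 1) / N) * Real.log (((x : ℝ) + N) / N)))) ∧
    (∀ μ : Measure unitInterval, IsProbabilityMeasure μ → NCF.AssumptionA μ →
      NCF.HasLipschitzDensity μ →
      ∃ q ℓ : ℝ, 0 < q ∧ q < 1 ∧ 0 < ℓ ∧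
        ∀ (x : unitInterval) (n : ℕ), 1 ≤ n →
          ∃ θ : ℝ, |θ| ≤ ℓ ∧
            NCF.distrib N μ n x =
              (1 + θ * q ^ n) / Real.log (((N : ℝ) + 1) / N) * Real.log (((x : ℝ) + N) / N) ∧
            NCF.errorTerm N μ n x =
              θ * q ^ n / Real.log (((N : ℝ) + 1) / N) * Real.log (((x : ℝ) + N) / N)) := by
  rw [add_comm (N : ℝ) 1]
  constructor
  · rintro μ hμ ⟨-, h, ⟨-, hd⟩, -⟩ x
    obtain ⟨k, hk, hS⟩ := NCF.exists_integrableOn_density (μ := μ)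
      (hd ▸ withDensity_absolutelyContinuous _ _)
    have htot := hS Set.univ MeasurableSet.univ
    have : IsProbabilityMeasure (μ.map ((↑) : unitInterval → ℝ)) :=
      Measure.isProbabilityMeasure_map (by fun_prop)
    rw [probReal_univ, Set.univ_inter] at htot
    have := NCF.tendsto_setIntegral_realMap_lt hN hk x.2
    rw [← htot] at this
    refine this.congr fun n => ?_
    rw [NCF.distrib_eq_map, hS _ (NCF.measurableSet_realMap_lt N n x)]
  · rintro μ hμ - ⟨h, hd, K, hK⟩
    obtain ⟨M, hM, hb⟩ := (NCF.lipUnit_IccExtend hK).abs_setIntegral_sub_le hN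
    have hS : ∀ S : Set ℝ, MeasurableSet S → _ := fun S hS =>
      NCF.measureReal_map_eq_setIntegral hd hK.continuous hS
    have htot := hS Set.univ MeasurableSet.univ
    have : IsProbabilityMeasure (μ.map ((↑) : unitInterval → ℝ)) :=
      Measure.isProbabilityMeasure_map (by fun_prop)
    rw [probReal_univ, Set.univ_inter] at htot
    have hℓ0 : 0 < Real.log ((1 + (N : ℝ)) / N) := NCF.log_ratio_pos hN one_pos
    -- The `+ 1` makes the bound positive even when `M = 0`.
    refine ⟨7 / 8, M * Real.log ((1 + N) / N) + 1, by norm_num, by norm_num, by positivity,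
      fun x n _ => ?_⟩
    have hx := hb n x x.2
    rw [← htot, ← hS _ (NCF.measurableSet_realMap_lt N n x), ← NCF.distrib_eq_map] at hx
    have key : ∃ θ : ℝ, |θ| ≤ M * Real.log ((1 + N) / N) + 1 ∧ NCF.distrib N μ n x =
        (1 + θ * (7 / 8) ^ n) / Real.log ((1 + (N : ℝ)) / N) * Real.log (((x : ℝ) + N) / N) := by
      rcases x.2.1.eq_or_lt with h0 | h0
      -- At `x = 0` the logarithm vanishes and so does the distribution; any `θ` fits.
      · refine ⟨0, by simpa using by positivity, ?_⟩
        have : Real.log (((x : ℝ) + N) / N) = 0 := by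
          have : (N : ℝ) ≠ 0 := by positivity
          simp [← h0, this]
        rw [this] at hx ⊢
        simpa using hx
      · have hr0 := NCF.log_ratio_pos hN h0
        set ℓ := Real.log ((1 + (N : ℝ)) / N)
        set r := Real.log (((x : ℝ) + N) / N)
        set D := NCF.distrib N μ n x
        -- This is the required equation solved for `θ`; the factor `r` in the error bound cancels,
        -- so the bound on `θ` is uniform in `x`.
        refine ⟨(D - 1 / ℓ * r) * ℓ / ((7 / 8) ^ n * r), ?_, ?_⟩
        · rw [abs_div, abs_mul, abs_of_pos hℓ0, abs_of_pos (a := (7 / 8) ^ n * r) (by positivity),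
            div_le_iff₀ (by positivity)]
          have h1 := mul_le_mul_of_nonneg_right hx hℓ0.le
          have h2 : 0 ≤ (7 / 8) ^ n * r := by positivity
          linarith
        · field_simp
          ring
    obtain ⟨θ, hθ, e⟩ := key
    refine ⟨θ, hθ, e, ?_⟩
    rw [NCF.errorTerm, NCF.limitDistrib, e, add_comm (N : ℝ) 1]
    ring
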